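/- **Quantum sampling oracle.** For $N,T\ge 1$ write $[N]=\{0,\dots,N-1\}$. Let $D$ be a probability distribution on $[N]$ that is represented by a map $O_D:[T]\to[N]$, i.e. $D(i)=|\{t\in[T]:O_D(t)=i\}|/T$ for all $i\in[N]$, and put $D(S)=\sum_{i\in S}D(i)$ for $S\subseteq[N]$. One query to $\mathsf{QSAMP}_D$ applies the unitary $U_D|t\rangle|\beta\rangle=|t\rangle|\beta+O_D(t) \bmod N\rangle$ ($t\in[T]$, $\beta\in[N]$). A quantum algorithm making exactly $M$ queries starts in a fixed basis state of the two registers and a finite-dimensional workspace, applies $V_MU_DV_{M-1}U_D\cdots U_DV_0$ with unitaries $V_0,\dots,V_M$ that do not depend on $O_D$ ($U_D$ acting trivially on the workspace), measures in the computational basis, and outputs a real number that is a fixed function of the measurement result. **Theorem.** There are an absolute constant $c>0$ and a quantum algorithm $\textsc{MulEstProb}$ (a family of such algorithms, indexed by $N$, $T$ and the following inputs) that, given a set $S\subseteq[N]$, an integer $M\ge 0$ and a confidence parameter $\delta\in(0,1]$, makes exactly $M$ queries to $\mathsf{QSAMP}_D$ and outputs a number $\tilde D(S)$ such that, for every probability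 distribution $D$ on $[N]$ represented by a map $O_D:[T]\to[N]$ with $D(S)>0$, and for every $\epsilon\in(0,1]$ satisfying $$M\ \ge\ \frac{c\,\log(1/\delta)}{\epsilon\sqrt{D(S)}},$$ one has $$\mathbb{P}\bigl[(1-\epsilon)D(S)\le\tilde D(S)\le(1+\epsilon)D(S)\bigr]\ \ge\ 1-\delta .$$ Neither $D$ nor $\epsilon$ is an input of the algorithm (apart from the queries), and $c$ does not depend on $N,T,D,O_D,S,M,\epsilon,\delta$. -/

import Mathlib

open scoped Matrix

namespace QSamp

/-- The weight `D(S) = ∑_{i ∈ S} D(i)` of a set `S ⊆ [N]`. -/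
noncomputable def weight {N : ℕ} (D : Fin N → ℝ) (S : Finset (Fin N)) : ℝ :=
  ∑ i ∈ S, D i

/-- The labelling `O : [T] → [N]` represents `D`: for each `i`,
`D(i) = |{t ∈ [T] : O(t) = i}| / T`. -/
def Represents {N T : ℕ} (O : Fin T → Fin N) (D : Fin N → ℝ) : Prop :=
  ∀ i, D i = ((Finset.univ.filter fun t => O t = i).card : ℝ) / (T : ℝ)

/-- Computational basis labels `|t⟩|β⟩|w⟩`: the two registers on which the oracle acts, and a
workspace register of dimension `W` that the oracle leaves alone. -/
abbrev Reg (N T W : ℕ) : Type := Fin T × Fin N × Fin W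

/-- The matrix of one query to the quantum sampling oracle given by the labelling `O`:
`|t⟩|β⟩|w⟩ ↦ |t⟩|β + O(t) mod N⟩|w⟩` (addition in `Fin N` is modulo `N`). -/
def oracle {N T : ℕ} [NeZero N] (W : ℕ) (O : Fin T → Fin N) :
    Matrix (Reg N T W) (Reg N T W) ℂ :=
  Matrix.of fun y x => if y = (x.1, x.2.1 + O x.1, x.2.2) then 1 else 0

theorem oracle_mulVec_single {N T : ℕ} [NeZero N] (W : ℕ) (O : Fin T → Fin N)
    (t : Fin T) (b : Fin N) (w : Fin W) :
    oracle W O *ᵥ Pi.single (t, b, w) 1 = Pi.single (t, b + O t, w) 1 := by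
  ext y
  simp [oracle, Pi.single_apply]

theorem oracle_mem_unitaryGroup {N T : ℕ} [NeZero N] (W : ℕ) (O : Fin T → Fin N) :
    oracle W O ∈ Matrix.unitaryGroup (Reg N T W) ℂ := by
  rw [Matrix.mem_unitaryGroup_iff']
  ext x y
  rw [Matrix.mul_apply, Finset.sum_eq_single (y.1, y.2.1 + O y.1, y.2.2)]
  · obtain ⟨t, b, w⟩ := x
    obtain ⟨t', b', w'⟩ := y
    by_cases h : t' = t
    · subst h
      simp [oracle, Matrix.one_apply, apply_ite, eq_comm]
    · simp [oracle, h, Ne.symm h]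
  · intro z _ hz
    simp [oracle, hz]
  · simp

/-- A quantum query algorithm with real output for the quantum sampling oracle. It starts in the
basis state `init`, applies `V 0`, then `queries` times in a row one oracle query followed by the
next unitary `V 1, V 2, …`, measures in the computational basis, and outputs the number that
`out` assigns to the measured label. The unitaries do not depend on the labelling in the oracle.
(Classical randomness and intermediate measurements are covered by the workspace.) -/
structure QueryAlgorithm (N T : ℕ) where
  /-- the number of oracle queries -/
  queries : ℕ
  /-- the dimension of the workspace -/
  work : ℕ
  /-- the initial basis state -/
  init : Reg N T work
  /-- the unitaries applied between the queries (only `V 0, …, V queries` are used) -/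
  V : ℕ → Matrix.unitaryGroup (Reg N T work) ℂ
  /-- classical post-processing of the measured label -/
  out : Reg N T work → ℝ

namespace QueryAlgorithm

variable {N T : ℕ} [NeZero N] (A : QueryAlgorithm N T) (O : Fin T → Fin N)

/-- The state vector after `k` queries and the unitary that follows the last of them. -/
noncomputable def stateAfter : ℕ → Reg N T A.work → ℂ
  | 0 => (A.V 0).1 *ᵥ Pi.single A.init 1
  | k + 1 => (A.V (k + 1)).1 *ᵥ (oracle A.work O *ᵥ stateAfter k)

open Classical in
/-- The probability that the output of the algorithm, run with the oracle given by `O`, lies in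
the set `E`. -/
noncomputable def outputProb (E : Set ℝ) : ℝ :=
  ∑ x : Reg N T A.work, if A.out x ∈ E then ‖A.stateAfter O A.queries x‖ ^ 2 else 0

end QueryAlgorithm

end QSamp

namespace QSamp

open Matrix Kronecker Polynomial

/-! ### State preparation and norm preservation for unitary matrices. -/

section Unitary

variable {ι : Type*} [Fintype ι] [DecidableEq ι]

/-! Write `D(S) = sin² θ`. A Grover iteration costs two queries (compute and uncompute the label)
and rotates the plane of marked and unmarked labels by `2θ`, so `j` iterations produce amplitudes
proportional to `sin ((2j+1)θ)` and `cos ((2j+1)θ)` (`groverState_even`). Let a control register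
hold `j` with amplitude proportional to the `j`-th coefficient of a polynomial `q` of degree at most
`M / 2`. A final Fourier transform of that register yields `k` with probability the average of the
normalised values of `|q|²` at `exp (i(±2θ - 2πk/L))` (`outputProb_amplitudeEstimation`). The output
`sin² (πk/L)` has relative error at most `ε` once `|sin (±θ - πk/L)| ≤ ε sin θ / 3`
(`sin_sq_mem_Icc`), and the lower bound on `M` makes `resolution` at most this tolerance, although
the algorithm does not know `ε`.

Confidence comes from the window, not from repetition: for `q = (1 + X + ⋯ + X^(ℓ-1))^(s+1)` with `s
= ⌈log (1/δ)⌉` and `ℓ` of order `M / s`, the mass outside the tolerance decays exponentially in `s`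
(`sum_gridWeight_tail_le`).

This fails for `δ` near `1`, where `M` may be far below `1 / (ε sin θ)` and no concentration at the
required scale is possible. There, however, a success probability of `1 - δ ≤ log (1/δ)` suffices,
and the peak of the Fejér window `s = 0` already puts mass of order `ℓη` within distance `η`
(`le_sum_gridWeight_peak`). -/

theorem exists_unitary_mulVec_single (i₀ : ι) (v : ι → ℂ) (hv : ∑ i, ‖v i‖ ^ 2 = 1) :
    ∃ U : unitaryGroup ι ℂ, U.1 *ᵥ Pi.single i₀ 1 = v := by
  have hon : Orthonormal ℂ (({i₀} : Set ι).domRestrict fun _ : ι => WithLp.toLp 2 v) := by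
    rw [orthonormal_iff_ite]
    rintro ⟨i, hi⟩ ⟨j, hj⟩
    obtain rfl : i = i₀ := hi
    obtain rfl : j = i := hj
    rw [if_pos rfl]
    change inner ℂ (WithLp.toLp 2 v) (WithLp.toLp 2 v) = 1
    have h : ‖WithLp.toLp 2 v‖ ^ 2 = 1 := by
      rw [EuclideanSpace.norm_sq_eq]
      exact hv
    rw [inner_self_eq_norm_sq_to_K, ← RCLike.ofReal_pow, h, RCLike.ofReal_one]
  obtain ⟨b, hb⟩ := hon.exists_orthonormalBasis_extension_of_card_eq (ι := ι)
    (E := EuclideanSpace ℂ ι) (by simp)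
  refine ⟨⟨Matrix.of fun i j => b j i, ?_⟩, ?_⟩
  · rw [mem_unitaryGroup_iff']
    ext i j
    have h := orthonormal_iff_ite.1 b.orthonormal i j
    rw [PiLp.inner_apply] at h
    simp only [RCLike.inner_apply] at h
    rw [mul_apply, one_apply, ← h]
    refine Finset.sum_congr rfl fun k _ => ?_
    simp [star_apply, mul_comm]
  · ext i
    simp [hb i₀ rfl]

/-- A unitary that maps the basis vector `i₀` to `v`, for a unit vector `v`. -/
noncomputable def prepare (i₀ : ι) (v : ι → ℂ) : unitaryGroup ι ℂ :=
  open Classical in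
  if h : ∃ U : unitaryGroup ι ℂ, U.1 *ᵥ Pi.single i₀ 1 = v then h.choose else 1

theorem prepare_mulVec_single (i₀ : ι) {v : ι → ℂ} (hv : ∑ i, ‖v i‖ ^ 2 = 1) :
    (prepare i₀ v).1 *ᵥ Pi.single i₀ 1 = v := by
  have h := exists_unitary_mulVec_single i₀ v hv
  rw [prepare, dif_pos h]
  exact h.choose_spec

theorem sum_norm_sq_mulVec {U : Matrix ι ι ℂ} (hU : U ∈ unitaryGroup ι ℂ) (v : ι → ℂ) :
    ∑ i, ‖(U *ᵥ v) i‖ ^ 2 = ∑ i, ‖v i‖ ^ 2 := by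
  have key : ∀ w : ι → ℂ, ((∑ i, ‖w i‖ ^ 2 : ℝ) : ℂ) = star w ⬝ᵥ w := by
    intro w
    simp [dotProduct, Complex.conj_mul']
  apply Complex.ofReal_injective
  rw [key, key, star_mulVec, dotProduct_mulVec, vecMul_vecMul, ← star_eq_conjTranspose,
    mem_unitaryGroup_iff'.1 hU, vecMul_one]

end Unitary

/-! ### Unitarity of the discrete Fourier transform. -/

section Fourier

/-- The matrix of the quantum Fourier transform on `ℂ^L` (with negative exponents). -/
noncomputable def dftMatrix (L : ℕ) : Matrix (Fin L) (Fin L) ℂ :=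
  Matrix.of fun k j => Complex.exp (-(2 * Real.pi * (k : ℕ) / L : ℝ) * Complex.I) ^ (j : ℕ) / √(L : ℝ)

theorem dftMatrix_mem_unitaryGroup (L : ℕ) [NeZero L] :
    dftMatrix L ∈ unitaryGroup (Fin L) ℂ := by
  have hL : (L : ℂ) ≠ 0 := by exact_mod_cast NeZero.ne L
  have hζ := Complex.isPrimitiveRoot_exp L (NeZero.ne L)
  set ζ := Complex.exp (2 * Real.pi * Complex.I / L) with hζdef
  have hζ0 : ζ ≠ 0 := Complex.exp_ne_zero _
  have hF : ∀ k j : Fin L, dftMatrix L k j = (ζ⁻¹ ^ (k : ℕ)) ^ (j : ℕ) / √(L : ℝ) := by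
    intro k j
    have h : ζ⁻¹ ^ (k : ℕ) = Complex.exp (-(2 * Real.pi * (k : ℕ) / L : ℝ) * Complex.I) := by
      rw [hζdef, ← Complex.exp_neg, ← Complex.exp_nat_mul]
      congr 1
      push_cast
      ring
    rw [dftMatrix, of_apply, h]
  have hconj : (starRingEnd ℂ) ζ = ζ⁻¹ := by
    rw [hζdef, ← Complex.exp_conj, ← Complex.exp_neg]
    congr 1
    simp only [map_div₀, map_mul, map_ofNat, Complex.conj_ofReal, Complex.conj_I, map_natCast]
    ring
  rw [mem_unitaryGroup_iff']
  ext i j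
  rw [mul_apply]
  have hterm : ∀ k : Fin L, star (dftMatrix L) i k * dftMatrix L k j
      = (ζ ^ (i : ℕ) * ζ⁻¹ ^ (j : ℕ)) ^ (k : ℕ) / L := by
    intro k
    have hs : ((√(L : ℝ) : ℝ) : ℂ) * (√(L : ℝ) : ℝ) = L := by
      rw [← Complex.ofReal_mul, Real.mul_self_sqrt (Nat.cast_nonneg L), Complex.ofReal_natCast]
    rw [star_apply, hF, hF]
    simp only [RCLike.star_def, map_div₀, map_pow, map_inv₀, hconj, inv_inv, Complex.conj_ofReal]
    rw [div_mul_div_comm, hs, mul_pow]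
    congr 1
    simp only [← pow_mul]
    rw [mul_comm (k : ℕ) i, mul_comm (k : ℕ) j]
  rw [Finset.sum_congr rfl fun k _ => hterm k, ← Finset.sum_div,
    Fin.sum_univ_eq_sum_range fun k => (ζ ^ (i : ℕ) * ζ⁻¹ ^ (j : ℕ)) ^ k]
  by_cases hij : i = j
  · subst hij
    rw [inv_pow, mul_inv_cancel₀ (pow_ne_zero _ hζ0)]
    simp [hL]
  · rw [one_apply_ne hij]
    have hne : ζ ^ (i : ℕ) * ζ⁻¹ ^ (j : ℕ) - 1 ≠ 0 := by
      intro h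
      rw [sub_eq_zero, inv_pow, mul_inv_eq_one₀ (pow_ne_zero _ hζ0)] at h
      exact hij (Fin.ext (hζ.pow_inj i.2 j.2 h))
    have hg := mul_geom_sum (ζ ^ (i : ℕ) * ζ⁻¹ ^ (j : ℕ)) L
    rw [mul_pow, ← pow_mul, ← pow_mul, mul_comm (i : ℕ), mul_comm (j : ℕ), pow_mul, pow_mul,
      inv_pow ζ L, hζ.pow_eq_one] at hg
    simp only [inv_one, one_pow, mul_one, sub_self, mul_eq_zero, hne, false_or] at hg
    rw [hg, zero_div]

end Fourier

/-! ### The gates of the circuit: unitarity and action on vectors. -/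

section Gates

variable {N T : ℕ}

/-- The gate `|t⟩|β⟩|w⟩ ↦ s(t, β, w) |t⟩|-β⟩|w⟩`. -/
def signedNeg {W : ℕ} (s : Reg N T W → ℤˣ) : Matrix (Reg N T W) (Reg N T W) ℂ :=
  Matrix.of fun y x => if y = (x.1, -x.2.1, x.2.2) then ((s x : ℤ) : ℂ) else 0

theorem signedNeg_mulVec_apply {W : ℕ} (s : Reg N T W → ℤˣ) (v : Reg N T W → ℂ)
    (t : Fin T) (b : Fin N) (w : Fin W) :
    (signedNeg s *ᵥ v) (t, b, w) = ((s (t, -b, w) : ℤ) : ℂ) * v (t, -b, w) := by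
  rw [mulVec, dotProduct, Finset.sum_eq_single (t, -b, w)]
  · simp [signedNeg]
  · rintro ⟨t', b', w'⟩ _ h
    simp only [signedNeg, of_apply]
    rw [if_neg, zero_mul]
    rintro h'
    simp only [Prod.mk.injEq] at h'
    obtain ⟨rfl, rfl, rfl⟩ := h'
    simp at h
  · simp

theorem signedNeg_mem_unitaryGroup {W : ℕ} (s : Reg N T W → ℤˣ) :
    signedNeg s ∈ unitaryGroup (Reg N T W) ℂ := by
  rw [mem_unitaryGroup_iff']
  ext x y
  rw [mul_apply, Finset.sum_eq_single (y.1, -y.2.1, y.2.2)]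
  · by_cases h : x = y
    · subst h
      rcases Int.units_eq_one_or (s x) with h | h <;> simp [signedNeg, h]
    · rw [one_apply_ne h, star_apply]
      simp only [signedNeg, of_apply]
      rw [if_neg, star_zero, zero_mul]
      intro h'
      apply h
      simp only [Prod.mk.injEq, neg_inj] at h'
      ext1
      · exact h'.1.symm
      · ext1
        · exact h'.2.1.symm
        · exact h'.2.2.symm
  · intro z _ hz
    simp [signedNeg, hz]
  · simp

theorem oracle_mulVec_apply [NeZero N] (W : ℕ) (O : Fin T → Fin N) (v : Reg N T W → ℂ)
    (t : Fin T) (b : Fin N) (w : Fin W) :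
    (oracle W O *ᵥ v) (t, b, w) = v (t, b - O t, w) := by
  rw [mulVec, dotProduct, Finset.sum_eq_single (t, b - O t, w)]
  · simp [oracle]
  · rintro ⟨t', b', w'⟩ _ h
    simp only [oracle, of_apply]
    rw [if_neg, zero_mul]
    rintro h'
    simp only [Prod.mk.injEq] at h'
    obtain ⟨rfl, rfl, rfl⟩ := h'
    simp at h
  · simp

/-- Grover's diffusion operator, the reflection about the uniform superposition. -/
noncomputable def diffusion (T : ℕ) : Matrix (Fin T) (Fin T) ℂ :=
  Matrix.of (fun _ _ => (2 / T : ℂ)) - 1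

theorem diffusion_mulVec_apply (v : Fin T → ℂ) (t : Fin T) :
    (diffusion T *ᵥ v) t = 2 / T * ∑ t', v t' - v t := by
  rw [diffusion, sub_mulVec, one_mulVec, Pi.sub_apply, mulVec, dotProduct, Finset.mul_sum]
  rfl

theorem diffusion_mem_unitaryGroup [NeZero T] : diffusion T ∈ unitaryGroup (Fin T) ℂ := by
  have hT : (T : ℂ) ≠ 0 := by exact_mod_cast NeZero.ne T
  have hs : star (diffusion T) = diffusion T := by
    ext i j
    simp [diffusion, one_apply, eq_comm]
  -- The matrix is self-adjoint, so it remains to see that it is an involution, which is checked on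
  -- vectors.
  rw [mem_unitaryGroup_iff', hs, ← Matrix.mulVec_injective.eq_iff]
  funext v
  ext t
  rw [← mulVec_mulVec, diffusion_mulVec_apply, one_mulVec]
  simp only [diffusion_mulVec_apply, Finset.sum_sub_distrib, Finset.sum_const, Finset.card_univ,
    Fintype.card_fin, nsmul_eq_mul]
  field_simp
  ring

/-- The diffusion operator on the first register, controlled by the condition `p` on the
workspace. -/
noncomputable def controlledDiffusion (N T : ℕ) {W : ℕ} (p : Fin W → Prop) [DecidablePred p] :
    Matrix (Reg N T W) (Reg N T W) ℂ :=
  blockDiagonal fun x : Fin N × Fin W => if p x.2 then diffusion T else 1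

theorem controlledDiffusion_mem_unitaryGroup [NeZero T] {W : ℕ} (p : Fin W → Prop)
    [DecidablePred p] : controlledDiffusion N T p ∈ unitaryGroup (Reg N T W) ℂ := by
  rw [mem_unitaryGroup_iff', controlledDiffusion, star_eq_conjTranspose,
    blockDiagonal_conjTranspose, ← blockDiagonal_mul, ← blockDiagonal_one]
  congr 1
  funext x
  split_ifs
  · exact mem_unitaryGroup_iff'.1 diffusion_mem_unitaryGroup
  · simp

theorem controlledDiffusion_mulVec_apply {W : ℕ} (p : Fin W → Prop) [DecidablePred p]
    (v : Reg N T W → ℂ) (t : Fin T) (b : Fin N) (w : Fin W) :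
    (controlledDiffusion N T p *ᵥ v) (t, b, w) =
      if p w then 2 / T * ∑ t', v (t', b, w) - v (t, b, w) else v (t, b, w) := by
  have : (controlledDiffusion N T p *ᵥ v) (t, b, w) =
      ((if p w then diffusion T else 1) *ᵥ fun t' => v (t', b, w)) t := by
    rw [mulVec, mulVec, dotProduct, dotProduct, Fintype.sum_prod_type]
    refine Finset.sum_congr rfl fun t' _ => ?_
    rw [Finset.sum_eq_single (b, w)]
    · simp [controlledDiffusion, blockDiagonal_apply]
    · intro x _ hx
      simp [controlledDiffusion, blockDiagonal_apply, hx.symm]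
    · simp
  rw [this]
  split_ifs
  · rw [diffusion_mulVec_apply]
  · rw [one_mulVec]

/-- The Fourier transform on the workspace register. -/
noncomputable def workspaceDft (N T L : ℕ) : Matrix (Reg N T L) (Reg N T L) ℂ :=
  (1 : Matrix (Fin T) (Fin T) ℂ) ⊗ₖ ((1 : Matrix (Fin N) (Fin N) ℂ) ⊗ₖ dftMatrix L)

theorem workspaceDft_mem_unitaryGroup (L : ℕ) [NeZero L] :
    workspaceDft N T L ∈ unitaryGroup (Reg N T L) ℂ :=
  kronecker_mem_unitary (one_mem _)
    (kronecker_mem_unitary (one_mem _) (dftMatrix_mem_unitaryGroup L))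

theorem workspaceDft_mulVec_apply (L : ℕ) (v : Reg N T L → ℂ) (t : Fin T) (b : Fin N)
    (k : Fin L) :
    (workspaceDft N T L *ᵥ v) (t, b, k) = (dftMatrix L *ᵥ fun j => v (t, b, j)) k := by
  rw [mulVec, mulVec, dotProduct, dotProduct, Fintype.sum_prod_type, Finset.sum_eq_single t,
    Fintype.sum_prod_type, Finset.sum_eq_single b]
  · simp [workspaceDft]
  · intro b' _ hb
    simp [workspaceDft, one_apply_ne hb.symm]
  · simp
  · intro t' _ ht
    simp [workspaceDft, one_apply_ne ht.symm]
  · simp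

end Gates

/-! ### Amplitude estimation and the states it passes through. -/

section Algorithm

variable {N T : ℕ}

/-- The `k`-th unitary of the Grover iteration in superposition: odd steps flip the sign of the
labels in `S`, even steps apply the diffusion operator, both controlled by the value of the
workspace register; in addition the query register is negated, so that the next query undoes the
last one. -/
noncomputable def groverStep (S : Finset (Fin N)) {L : ℕ} (k : ℕ) :
    Matrix (Reg N T L) (Reg N T L) ℂ :=
  -- Steps `2i + 1` and `2i + 2` form iteration `i`, counted from `0`; the two conditions on the
  -- workspace value `j` both amount to `i < j`.
  if k % 2 = 1 then signedNeg fun x => if x.2.1 ∈ S ∧ k / 2 < x.2.2 then -1 else 1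
  else signedNeg (fun _ => 1) * controlledDiffusion N T fun j : Fin L => k / 2 ≤ j

theorem groverStep_mem_unitaryGroup [NeZero T] (S : Finset (Fin N)) {L : ℕ} (k : ℕ) :
    groverStep S k ∈ unitaryGroup (Reg N T L) ℂ := by
  rw [groverStep]
  split_ifs
  · exact signedNeg_mem_unitaryGroup _
  · exact mul_mem (signedNeg_mem_unitaryGroup _) (controlledDiffusion_mem_unitaryGroup _)

/-- The initial state `T^{-1/2} ∑_{t, j} a_j |t⟩|0⟩|j⟩`. -/
noncomputable def initialState (N T : ℕ) [NeZero N] {L : ℕ} (a : Fin L → ℝ) :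
    Reg N T L → ℂ :=
  fun x => if x.2.1 = 0 then ((a x.2.2 / √(T : ℝ) : ℝ) : ℂ) else 0

theorem sum_norm_sq_initialState [NeZero N] [NeZero T] {L : ℕ} {a : Fin L → ℝ}
    (ha : ∑ j, a j ^ 2 = 1) : ∑ x, ‖initialState N T a x‖ ^ 2 = 1 := by
  have hT : (T : ℝ) ≠ 0 := by exact_mod_cast NeZero.ne T
  rw [Fintype.sum_prod_type]
  have h : ∀ t : Fin T, ∑ y : Fin N × Fin L, ‖initialState N T a (t, y)‖ ^ 2 = 1 / T := by
    intro t
    rw [Fintype.sum_prod_type, Finset.sum_eq_single 0]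
    · simp only [initialState, if_true, Complex.norm_real, Real.norm_eq_abs, sq_abs, div_pow,
        Real.sq_sqrt (Nat.cast_nonneg T)]
      rw [← Finset.sum_div, ha]
    · intro b _ hb
      simp [initialState, hb]
    · simp
  simp [h, hT]

/-- The unitaries of amplitude estimation: `groverStep`s after the preparation of the initial state,
and a Fourier transform of the control register at the end. -/
noncomputable def amplitudeUnitary (N T : ℕ) [NeZero N] [NeZero T] (S : Finset (Fin N))
    (M L : ℕ) [NeZero L] (a : Fin L → ℝ) (k : ℕ) : unitaryGroup (Reg N T L) ℂ :=
  (if k = M then ⟨workspaceDft N T L, workspaceDft_mem_unitaryGroup L⟩ else 1) *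
  (if k = 0 then prepare 0 (initialState N T a)
    else ⟨groverStep S k, groverStep_mem_unitaryGroup S k⟩)

/-- Amplitude estimation with control amplitudes `a`. The measured value `k` of the control
register yields the output `sin² (π k / L)`. -/
noncomputable def amplitudeEstimation (N T : ℕ) [NeZero N] [NeZero T] (S : Finset (Fin N))
    (M L : ℕ) [NeZero L] (a : Fin L → ℝ) : QueryAlgorithm N T where
  queries := M
  work := L
  init := 0
  V := amplitudeUnitary N T S M L a
  out x := Real.sin (Real.pi * (x.2.2 : ℕ) / L) ^ 2

/-- The states that arise in amplitude estimation before the final Fourier transform. -/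
noncomputable def groverState [NeZero N] (S : Finset (Fin N)) (O : Fin T → Fin N) {L : ℕ}
    (a : Fin L → ℝ) : ℕ → Reg N T L → ℂ
  | 0 => initialState N T a
  | k + 1 => groverStep S (k + 1) *ᵥ (oracle L O *ᵥ groverState S O a k)

variable [NeZero N] [NeZero T] {S : Finset (Fin N)} {O : Fin T → Fin N} {L : ℕ} [NeZero L]
  {a : Fin L → ℝ}

theorem stateAfter_amplitudeEstimation_of_lt (ha : ∑ j, a j ^ 2 = 1) {M k : ℕ} (hk : k < M) :
    (amplitudeEstimation N T S M L a).stateAfter O k = groverState S O a k := by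
  induction k with
  | zero =>
    change (amplitudeUnitary N T S M L a 0).1 *ᵥ Pi.single 0 1 = _
    rw [amplitudeUnitary, if_neg hk.ne, if_pos rfl, one_mul,
      prepare_mulVec_single 0 (sum_norm_sq_initialState ha), groverState]
  | succ k ih =>
    rw [QueryAlgorithm.stateAfter, ih (by omega)]
    change (amplitudeUnitary N T S M L a (k + 1)).1 *ᵥ (oracle L O *ᵥ groverState S O a k) = _
    rw [amplitudeUnitary, if_neg hk.ne, if_neg k.succ_ne_zero, one_mul, groverState]

theorem stateAfter_amplitudeEstimation (ha : ∑ j, a j ^ 2 = 1) (M : ℕ) :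
    (amplitudeEstimation N T S M L a).stateAfter O M =
      workspaceDft N T L *ᵥ groverState S O a M := by
  cases M with
  | zero =>
    change (amplitudeUnitary N T S 0 L a 0).1 *ᵥ Pi.single 0 1 = _
    rw [amplitudeUnitary, if_pos rfl, if_pos rfl, Submonoid.coe_mul, ← mulVec_mulVec,
      prepare_mulVec_single 0 (sum_norm_sq_initialState ha), groverState]
  | succ k =>
    rw [QueryAlgorithm.stateAfter, stateAfter_amplitudeEstimation_of_lt ha (by omega)]
    change (amplitudeUnitary N T S (k + 1) L a (k + 1)).1 *ᵥ
      (oracle L O *ᵥ groverState S O a k) = _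
    rw [amplitudeUnitary, if_pos rfl, if_neg k.succ_ne_zero, Submonoid.coe_mul, ← mulVec_mulVec,
      groverState]

/-- The amplitude of `|t⟩` after `j` Grover iterations, where `sin² θ` is the proportion of the
labels in `S`. -/
noncomputable def groverAmplitude (S : Finset (Fin N)) (O : Fin T → Fin N) (θ : ℝ) (j : ℕ)
    (t : Fin T) : ℝ :=
  (if O t ∈ S then Real.sin ((2 * j + 1) * θ) / Real.sin θ
    else Real.cos ((2 * j + 1) * θ) / Real.cos θ) / √(T : ℝ)

omit [NeZero N] [NeZero T] in
theorem sum_groverAmplitude_split (f g : ℝ) :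
    ∑ t, (if O t ∈ S then f else g) =
      (Finset.univ.filter fun t => O t ∈ S).card * f +
        (T - (Finset.univ.filter fun t => O t ∈ S).card : ℝ) * g := by
  have h := Finset.card_filter_add_card_filter_not (s := Finset.univ) fun t => O t ∈ S
  rw [Finset.card_univ, Fintype.card_fin] at h
  have h' : (T : ℝ) = (Finset.univ.filter fun t => O t ∈ S).card +
      (Finset.univ.filter fun t => O t ∉ S).card := by exact_mod_cast h.symm
  rw [Finset.sum_ite, Finset.sum_const, Finset.sum_const, nsmul_eq_mul, nsmul_eq_mul, h']
  ring

variable {θ : ℝ}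

-- If `cos θ = 0`, then the proportion of labels in `S` is `1`. Hence the quotient by `cos θ` in
-- `groverAmplitude` is never a division by zero where it is used.
omit [NeZero N] [NeZero T] in
theorem cos_ne_zero_of_notMem
    (hθ : ((Finset.univ.filter fun t => O t ∈ S).card : ℝ) = T * Real.sin θ ^ 2) {t : Fin T}
    (ht : O t ∉ S) : Real.cos θ ≠ 0 := by
  intro h
  have h1 : Real.sin θ ^ 2 = 1 := by
    have := Real.sin_sq_add_cos_sq θ
    rw [h] at this
    linarith
  rw [h1, mul_one, Nat.cast_inj] at hθ
  have h2 := (Finset.card_filter_eq_iff (s := Finset.univ) (p := fun t => O t ∈ S)).1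
    (by rw [hθ, Finset.card_univ, Fintype.card_fin])
  exact ht (h2 t (Finset.mem_univ t))

omit [NeZero N] in
/-- One Grover iteration: a sign flip followed by the diffusion operator. -/
theorem groverAmplitude_succ
    (hθ : ((Finset.univ.filter fun t => O t ∈ S).card : ℝ) = T * Real.sin θ ^ 2)
    (hs : Real.sin θ ≠ 0) (j : ℕ) (t : Fin T) :
    2 / T * ∑ t', (if O t' ∈ S then -1 else 1) * groverAmplitude S O θ j t' -
      (if O t ∈ S then -1 else 1) * groverAmplitude S O θ j t = groverAmplitude S O θ (j + 1) t := by
  have hT : (T : ℝ) ≠ 0 := by exact_mod_cast NeZero.ne T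
  have hcc : (T - (Finset.univ.filter fun t => O t ∈ S).card : ℝ) = T * Real.cos θ ^ 2 := by
    rw [hθ, Real.cos_sq']
    ring
  -- The proportions `sin² θ` and `cos² θ` cancel the denominators, and twice the mean collapses by
  -- the addition formula; the rest is the sum-to-product formula at `(2j+2)θ ± θ`.
  have hmean : 2 / T * ∑ t', (if O t' ∈ S then -1 else 1) * groverAmplitude S O θ j t' =
      2 * Real.cos ((2 * j + 2) * θ) / √(T : ℝ) := by
    have : ∀ t', (if O t' ∈ S then -1 else 1) * groverAmplitude S O θ j t' =
        (if O t' ∈ S then -(Real.sin ((2 * j + 1) * θ) / Real.sin θ)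
          else Real.cos ((2 * j + 1) * θ) / Real.cos θ) / √(T : ℝ) := by
      intro t'
      rw [groverAmplitude]
      split_ifs <;> ring
    simp only [this]
    rw [← Finset.sum_div, sum_groverAmplitude_split, hcc, hθ]
    have h1 : (2 * j + 2) * θ = (2 * j + 1) * θ + θ := by ring
    have h2 : Real.sin θ ^ 2 / Real.sin θ = Real.sin θ := by field_simp
    -- This also holds for `cos θ = 0`, since a quotient by zero is `0`.
    have h3 : Real.cos θ ^ 2 / Real.cos θ = Real.cos θ := by
      rw [sq, mul_self_div_self]
    rw [h1, Real.cos_add]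
    calc _ = 2 / T * (T * (Real.cos ((2 * j + 1) * θ) * (Real.cos θ ^ 2 / Real.cos θ)
          - Real.sin ((2 * j + 1) * θ) * (Real.sin θ ^ 2 / Real.sin θ)) / √(T : ℝ)) := by ring
      _ = _ := by
        rw [h2, h3]
        field_simp
  rw [hmean, groverAmplitude, groverAmplitude]
  push_cast
  have h1 : (2 * ((j : ℝ) + 1) + 1) * θ = (2 * j + 2) * θ + θ := by ring
  have h2 : (2 * (j : ℝ) + 1) * θ = (2 * j + 2) * θ - θ := by ring
  rw [h1, h2, Real.cos_add, Real.cos_sub, Real.sin_add, Real.sin_sub]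
  by_cases ht : O t ∈ S
  · simp only [ht, if_true]
    field_simp
    ring
  · have hc := cos_ne_zero_of_notMem hθ ht
    simp only [ht, if_false]
    field_simp
    ring

omit [NeZero N] [NeZero T] in
theorem groverAmplitude_zero
    (hθ : ((Finset.univ.filter fun t => O t ∈ S).card : ℝ) = T * Real.sin θ ^ 2)
    (hs : Real.sin θ ≠ 0) (t : Fin T) : groverAmplitude S O θ 0 t = 1 / √(T : ℝ) := by
  rw [groverAmplitude]
  by_cases ht : O t ∈ S
  · simp [ht, hs]
  · simp [ht, cos_ne_zero_of_notMem hθ ht]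

-- The query writes `O t` into a zero register and the gate negates it, so that the next query will
-- restore `0`.
omit [NeZero T] [NeZero L] in
theorem groverState_odd {k : ℕ} {u : ℕ → Fin T → ℝ}
    (h : groverState S O a (2 * k) = fun x =>
      if x.2.1 = 0 then ((a x.2.2 * u x.2.2 x.1 : ℝ) : ℂ) else 0) :
    groverState S O a (2 * k + 1) = fun x =>
      if x.2.1 = -O x.1 then
        ((a x.2.2 * ((if O x.1 ∈ S ∧ k < x.2.2 then -1 else 1) * u x.2.2 x.1) : ℝ) : ℂ)
      else 0 := by
  rw [groverState, h]
  funext ⟨t, b, j⟩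
  have h1 : (2 * k + 1) % 2 = 1 := by omega
  have h2 : (2 * k + 1) / 2 = k := by omega
  rw [groverStep, if_pos h1, signedNeg_mulVec_apply, oracle_mulVec_apply, h2]
  have hb : -b - O t = 0 ↔ b = -O t := by
    rw [sub_eq_zero, neg_eq_iff_eq_neg]
  simp only [hb]
  by_cases h3 : b = -O t
  · subst h3
    simp only [neg_neg, if_true]
    split_ifs <;> simp
  · simp [h3]

-- Branch `j` stops rotating after `j` iterations, whence the `min`; its later queries merely cancel
-- in pairs.
omit [NeZero L] in
theorem groverState_even
    (hθ : ((Finset.univ.filter fun t => O t ∈ S).card : ℝ) = T * Real.sin θ ^ 2)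
    (hs : Real.sin θ ≠ 0) (k : ℕ) :
    groverState S O a (2 * k) = fun x =>
      if x.2.1 = 0 then ((a x.2.2 * groverAmplitude S O θ (min k x.2.2) x.1 : ℝ) : ℂ) else 0 := by
  induction k with
  | zero =>
    rw [mul_zero, groverState]
    funext ⟨t, b, j⟩
    simp only [initialState, Nat.zero_min, groverAmplitude_zero hθ hs]
    rw [mul_one_div]
  | succ k ih =>
    have h1 : 2 * (k + 1) = 2 * k + 1 + 1 := by ring
    rw [h1, groverState,
      groverState_odd (u := fun j t => groverAmplitude S O θ (min k j) t) ih]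
    funext ⟨t, b, j⟩
    have h2 : ¬ (2 * k + 1 + 1) % 2 = 1 := by omega
    have h3 : (2 * k + 1 + 1) / 2 = k + 1 := by omega
    rw [groverStep, if_neg h2, ← mulVec_mulVec, signedNeg_mulVec_apply,
      controlledDiffusion_mulVec_apply, h3]
    simp only [oracle_mulVec_apply]
    have hb : ∀ t, -b - O t = -O t ↔ b = 0 := by
      intro t
      rw [sub_eq_neg_self, neg_eq_zero]
    simp only [hb, Nat.succ_le_iff]
    by_cases hb0 : b = 0
    · simp only [hb0, if_true, Units.val_one, Int.cast_one, one_mul]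
      by_cases hj : k < j
      · simp only [hj, and_true, if_true, min_eq_left hj.le, min_eq_left (Nat.succ_le_of_lt hj)]
        rw [← groverAmplitude_succ hθ hs k t]
        push_cast
        rw [← Finset.mul_sum]
        ring
      · have h4 : min (k + 1) (j : ℕ) = j := min_eq_right (by omega)
        have h5 : min k (j : ℕ) = j := min_eq_right (by omega)
        simp [hj, h4, h5]
    · simp [hb0]

end Algorithm

/-! ### The distribution of the measured control value. -/

section OutputDistribution

/-- The sum of the squares of the coefficients of a polynomial. -/
noncomputable def coeffNormSq (q : ℝ[X]) : ℝ := ∑ j ∈ Finset.range (q.natDegree + 1), q.coeff j ^ 2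

theorem coeffNormSq_eq_sum {q : ℝ[X]} {n : ℕ} (h : q.natDegree < n) :
    coeffNormSq q = ∑ j ∈ Finset.range n, q.coeff j ^ 2 := by
  rw [coeffNormSq]
  refine Finset.sum_subset (Finset.range_mono h) fun j _ hj => ?_
  rw [coeff_eq_zero_of_natDegree_lt (by simpa [Nat.lt_succ_iff] using hj)]
  simp

theorem coeffNormSq_pos {q : ℝ[X]} (hq : q ≠ 0) : 0 < coeffNormSq q :=
  Finset.sum_pos' (fun _ _ => sq_nonneg _)
    ⟨q.natDegree, by simp, by have := leadingCoeff_ne_zero.2 hq; positivity⟩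

/-- The point `exp (i (ψ - 2 π k / L))` of the unit circle. -/
noncomputable def gridPoint (L : ℕ) (ψ : ℝ) (k : ℕ) : ℂ :=
  Complex.exp ((ψ - 2 * Real.pi * k / L : ℝ) * Complex.I)

/-- The Fejér-type density that the polynomial `q` induces on the grid `ψ - 2 π k / L`. -/
noncomputable def gridWeight (q : ℝ[X]) (L : ℕ) (ψ : ℝ) (k : ℕ) : ℝ :=
  ‖aeval (gridPoint L ψ k) q‖ ^ 2 / (L * coeffNormSq q)

theorem gridWeight_nonneg (q : ℝ[X]) (L : ℕ) (ψ : ℝ) (k : ℕ) : 0 ≤ gridWeight q L ψ k := by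
  have : 0 ≤ coeffNormSq q := Finset.sum_nonneg fun _ _ => sq_nonneg _
  rw [gridWeight]
  positivity

theorem dftMatrix_mulVec_coeff {q : ℝ[X]} {L : ℕ} (hq : q.natDegree < L) (ψ : ℝ) (k : Fin L) :
    (dftMatrix L *ᵥ fun j => (q.coeff j : ℂ) * Complex.exp (ψ * Complex.I) ^ (j : ℕ)) k =
      aeval (gridPoint L ψ k) q / √(L : ℝ) := by
  rw [mulVec, dotProduct, aeval_eq_sum_range' hq, Finset.sum_div,
    ← Fin.sum_univ_eq_sum_range fun j => q.coeff j • gridPoint L ψ k ^ j / ((√(L : ℝ) : ℝ) : ℂ)]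
  refine Finset.sum_congr rfl fun j _ => ?_
  have h : gridPoint L ψ k = Complex.exp (ψ * Complex.I) *
      Complex.exp (-(2 * Real.pi * (k : ℕ) / L : ℝ) * Complex.I) := by
    rw [gridPoint, ← Complex.exp_add]
    congr 1
    push_cast
    ring
  rw [h, dftMatrix, of_apply, mul_pow, Complex.real_smul]
  ring

/-- Parseval's identity on the grid. -/
theorem sum_norm_sq_aeval_gridPoint {q : ℝ[X]} {L : ℕ} [NeZero L] (hq : q.natDegree < L) (ψ : ℝ) :
    ∑ k : Fin L, ‖aeval (gridPoint L ψ k) q‖ ^ 2 = L * coeffNormSq q := by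
  have hL : (L : ℝ) ≠ 0 := by exact_mod_cast NeZero.ne L
  -- Unitarity of the Fourier transform, applied to the coefficients twisted by the phases `exp
  -- (iψj)`.
  have h := sum_norm_sq_mulVec (dftMatrix_mem_unitaryGroup L)
    fun j => (q.coeff j : ℂ) * Complex.exp (ψ * Complex.I) ^ (j : ℕ)
  simp only [dftMatrix_mulVec_coeff hq, norm_div, norm_mul, norm_pow,
    Complex.norm_exp_ofReal_mul_I, one_pow, mul_one, Complex.norm_real, Real.norm_eq_abs,
    div_pow, sq_abs, Real.sq_sqrt (Nat.cast_nonneg L)] at h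
  rw [← Finset.sum_div, Fin.sum_univ_eq_sum_range fun j => q.coeff j ^ 2,
    ← coeffNormSq_eq_sum hq] at h
  rw [← h]
  field_simp

theorem sum_gridWeight {q : ℝ[X]} {L : ℕ} [NeZero L] (hq : q.natDegree < L) (hq0 : q ≠ 0)
    (ψ : ℝ) : ∑ k : Fin L, gridWeight q L ψ k = 1 := by
  have hL : (L : ℝ) ≠ 0 := by exact_mod_cast NeZero.ne L
  simp only [gridWeight]
  rw [← Finset.sum_div, sum_norm_sq_aeval_gridPoint hq, div_self]
  exact mul_ne_zero hL (coeffNormSq_pos hq0).ne'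

/-- The control amplitudes given by the coefficients of `q`. -/
noncomputable def controlAmplitude (q : ℝ[X]) (L : ℕ) (j : Fin L) : ℝ :=
  q.coeff j / √(coeffNormSq q)

theorem sum_controlAmplitude_sq {q : ℝ[X]} {L : ℕ} (hq : q.natDegree < L) (hq0 : q ≠ 0) :
    ∑ j, controlAmplitude q L j ^ 2 = 1 := by
  have hZ := coeffNormSq_pos hq0
  simp only [controlAmplitude, div_pow, Real.sq_sqrt hZ.le]
  rw [← Finset.sum_div, Fin.sum_univ_eq_sum_range fun j => q.coeff j ^ 2, ← coeffNormSq_eq_sum hq,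
    div_self hZ.ne']

theorem norm_sq_dftMatrix_mulVec {q : ℝ[X]} {L : ℕ} (hq : q.natDegree < L) (hq0 : q ≠ 0)
    (θ : ℝ) (k : Fin L) :
    ‖(dftMatrix L *ᵥ fun j => (controlAmplitude q L j : ℂ) *
      Complex.exp (((2 * (j : ℕ) + 1) * θ : ℝ) * Complex.I)) k‖ ^ 2 =
      gridWeight q L (2 * θ) k := by
  have hZ := coeffNormSq_pos hq0
  have h : (fun j : Fin L => (controlAmplitude q L j : ℂ) *
      Complex.exp (((2 * (j : ℕ) + 1) * θ : ℝ) * Complex.I)) =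
      (Complex.exp (θ * Complex.I) / √(coeffNormSq q)) • fun j : Fin L =>
        (q.coeff j : ℂ) * Complex.exp ((2 * θ : ℝ) * Complex.I) ^ (j : ℕ) := by
    funext j
    have : Complex.exp (((2 * (j : ℕ) + 1) * θ : ℝ) * Complex.I) =
        Complex.exp (θ * Complex.I) * Complex.exp ((2 * θ : ℝ) * Complex.I) ^ (j : ℕ) := by
      rw [← Complex.exp_nat_mul, ← Complex.exp_add]
      congr 1
      push_cast
      ring
    rw [this, controlAmplitude, Pi.smul_apply, smul_eq_mul]
    push_cast
    ring
  rw [h, mulVec_smul, Pi.smul_apply, dftMatrix_mulVec_coeff hq, smul_eq_mul, norm_mul, norm_div,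
    norm_div, Complex.norm_exp_ofReal_mul_I, Complex.norm_real, Complex.norm_real,
    Real.norm_of_nonneg (Real.sqrt_nonneg _), Real.norm_of_nonneg (Real.sqrt_nonneg _), mul_pow,
    div_pow, div_pow, Real.sq_sqrt hZ.le, Real.sq_sqrt (Nat.cast_nonneg L), gridWeight]
  have := hZ.ne'
  field_simp

/-- With `x`, `y` the transforms of the sine and cosine parts, `y ± ix` are the transforms of the
phases `exp (±i(2j+1)θ)`; the parallelogram law then removes the cross terms. -/
theorem norm_sq_sin_add_norm_sq_cos {q : ℝ[X]} {L : ℕ} (hq : q.natDegree < L) (hq0 : q ≠ 0)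
    (θ : ℝ) (k : Fin L) :
    ‖(dftMatrix L *ᵥ fun j =>
        ((controlAmplitude q L j * Real.sin ((2 * (j : ℕ) + 1) * θ) : ℝ) : ℂ)) k‖ ^ 2 +
      ‖(dftMatrix L *ᵥ fun j =>
        ((controlAmplitude q L j * Real.cos ((2 * (j : ℕ) + 1) * θ) : ℝ) : ℂ)) k‖ ^ 2 =
      (gridWeight q L (2 * θ) k + gridWeight q L (-(2 * θ)) k) / 2 := by
  set x := (dftMatrix L *ᵥ fun j =>
        ((controlAmplitude q L j * Real.sin ((2 * (j : ℕ) + 1) * θ) : ℝ) : ℂ)) k with hx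
  set y := (dftMatrix L *ᵥ fun j =>
        ((controlAmplitude q L j * Real.cos ((2 * (j : ℕ) + 1) * θ) : ℝ) : ℂ)) k with hy
  have h1 : gridWeight q L (2 * θ) k = ‖y + Complex.I * x‖ ^ 2 := by
    rw [← norm_sq_dftMatrix_mulVec hq hq0, hx, hy, ← smul_eq_mul, ← Pi.smul_apply,
      ← mulVec_smul, ← Pi.add_apply, ← mulVec_add]
    congr 4
    funext j
    rw [Complex.exp_mul_I, Pi.add_apply, Pi.smul_apply, smul_eq_mul]
    push_cast
    ring
  have h2 : gridWeight q L (-(2 * θ)) k = ‖y - Complex.I * x‖ ^ 2 := by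
    rw [← mul_neg, ← norm_sq_dftMatrix_mulVec hq hq0, hx, hy, ← smul_eq_mul, ← Pi.smul_apply,
      ← mulVec_smul, ← Pi.sub_apply, ← mulVec_sub]
    congr 4
    funext j
    rw [mul_neg, Complex.exp_mul_I, Pi.sub_apply, Pi.smul_apply, smul_eq_mul, ← Complex.ofReal_cos,
      ← Complex.ofReal_sin, Real.cos_neg, Real.sin_neg]
    push_cast
    ring
  have h3 := parallelogram_law_with_norm ℝ y (Complex.I * x)
  rw [norm_mul, Complex.norm_I, one_mul] at h3
  rw [h1, h2]
  linarith

theorem cos_odd_mul_eq_zero {θ : ℝ} (h : Real.cos θ = 0) (j : ℕ) :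
    Real.cos ((2 * j + 1) * θ) = 0 := by
  induction j with
  | zero => simpa using h
  | succ j ih =>
    have h1 : (2 * ((j + 1 : ℕ) : ℝ) + 1) * θ = (2 * j + 1) * θ + θ + θ := by
      push_cast
      ring
    rw [h1, Real.cos_add, Real.cos_add, Real.sin_add, h, ih]
    ring

variable {N T : ℕ} [NeZero N] [NeZero T] {S : Finset (Fin N)} {O : Fin T → Fin N} {L : ℕ} {θ : ℝ}

/-- No control value exceeds `M / 2`, so every branch completes its `j` iterations. For odd `M` the
surplus query only leaves `-O t` in the query register and does not disturb the control register. -/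
theorem groverState_eq {a : Fin L → ℝ}
    (hθ : ((Finset.univ.filter fun t => O t ∈ S).card : ℝ) = T * Real.sin θ ^ 2)
    (hs : Real.sin θ ≠ 0) {M : ℕ} (ha : ∀ j : Fin L, M / 2 < j → a j = 0) :
    ∃ f : Fin T → Fin N, groverState S O a M = fun x =>
      if x.2.1 = f x.1 then ((a x.2.2 * groverAmplitude S O θ x.2.2 x.1 : ℝ) : ℂ) else 0 := by
  rcases Nat.even_or_odd' M with ⟨k, rfl | rfl⟩
  · refine ⟨0, ?_⟩
    rw [groverState_even hθ hs]
    funext ⟨t, b, j⟩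
    rcases le_or_gt (j : ℕ) k with hj | hj
    · simp [min_eq_right hj]
    · simp [ha j (by omega)]
  · refine ⟨fun t => -O t, ?_⟩
    rw [groverState_odd (u := fun j t => groverAmplitude S O θ (min k j) t)
      (groverState_even hθ hs k)]
    funext ⟨t, b, j⟩
    rcases le_or_gt (j : ℕ) k with hj | hj
    · simp [min_eq_right hj, hj.not_gt]
    · simp [ha j (by omega)]

/-- The distribution of the output of amplitude estimation. -/
theorem outputProb_amplitudeEstimation [NeZero L] {q : ℝ[X]}
    (hθ : ((Finset.univ.filter fun t => O t ∈ S).card : ℝ) = T * Real.sin θ ^ 2)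
    (hs : Real.sin θ ≠ 0) {M : ℕ} (hqM : q.natDegree ≤ M / 2) (hq : q.natDegree < L) (hq0 : q ≠ 0)
    (E : Set ℝ) [DecidablePred (· ∈ E)] :
    (amplitudeEstimation N T S M L (controlAmplitude q L)).outputProb O E =
      ∑ k : Fin L, if Real.sin (Real.pi * (k : ℕ) / L) ^ 2 ∈ E then
        (gridWeight q L (2 * θ) k + gridWeight q L (-(2 * θ)) k) / 2 else 0 := by
  classical
  have hT : (T : ℝ) ≠ 0 := by exact_mod_cast NeZero.ne T
  obtain ⟨f, hf⟩ := groverState_eq (a := controlAmplitude q L) hθ hs (M := M) fun j hj => by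
    rw [controlAmplitude, coeff_eq_zero_of_natDegree_lt (by omega), zero_div]
  have hstate := stateAfter_amplitudeEstimation (S := S) (O := O)
    (sum_controlAmplitude_sq hq hq0) M
  have hprob : (amplitudeEstimation N T S M L (controlAmplitude q L)).outputProb O E =
      ∑ x : Reg N T L, if Real.sin (Real.pi * (x.2.2 : ℕ) / L) ^ 2 ∈ E then
        ‖(workspaceDft N T L *ᵥ groverState S O (controlAmplitude q L) M) x‖ ^ 2 else 0 := by
    rw [← hstate, QueryAlgorithm.outputProb]
    refine Finset.sum_congr rfl fun x _ => ?_
    congr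
  have hsum : ∀ k : Fin L, ∑ t : Fin T, ∑ b : Fin N,
      ‖(workspaceDft N T L *ᵥ groverState S O (controlAmplitude q L) M) (t, b, k)‖ ^ 2 =
        (gridWeight q L (2 * θ) k + gridWeight q L (-(2 * θ)) k) / 2 := by
    intro k
    rw [← norm_sq_sin_add_norm_sq_cos hq hq0]
    set X := (dftMatrix L *ᵥ fun j =>
        ((controlAmplitude q L j * Real.sin ((2 * (j : ℕ) + 1) * θ) : ℝ) : ℂ)) k with hX
    set Y := (dftMatrix L *ᵥ fun j =>
        ((controlAmplitude q L j * Real.cos ((2 * (j : ℕ) + 1) * θ) : ℝ) : ℂ)) k with hY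
    have ht : ∀ t, ∑ b : Fin N,
        ‖(workspaceDft N T L *ᵥ groverState S O (controlAmplitude q L) M) (t, b, k)‖ ^ 2 =
          if O t ∈ S then ‖X‖ ^ 2 / (Real.sin θ ^ 2 * T) else ‖Y‖ ^ 2 / (Real.cos θ ^ 2 * T) := by
      intro t
      rw [Finset.sum_eq_single (f t)]
      · rw [workspaceDft_mulVec_apply, hf]
        simp only [if_true, groverAmplitude]
        have hscale : ∀ (u : Fin L → ℝ) (s : ℝ),
            ‖(dftMatrix L *ᵥ fun j =>
              ((controlAmplitude q L j * (u j / s / √(T : ℝ)) : ℝ) : ℂ)) k‖ ^ 2 =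
            ‖(dftMatrix L *ᵥ fun j => ((controlAmplitude q L j * u j : ℝ) : ℂ)) k‖ ^ 2 /
              (s ^ 2 * T) := by
          intro u s
          have : (fun j => ((controlAmplitude q L j * (u j / s / √(T : ℝ)) : ℝ) : ℂ)) =
              ((s⁻¹ * (√(T : ℝ))⁻¹ : ℝ) : ℂ) •
                fun j => ((controlAmplitude q L j * u j : ℝ) : ℂ) := by
            funext j
            rw [Pi.smul_apply, smul_eq_mul, ← Complex.ofReal_mul]
            congr 1
            ring
          rw [this, mulVec_smul, Pi.smul_apply, norm_smul, mul_pow, Complex.norm_real,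
            Real.norm_eq_abs, sq_abs, mul_pow, inv_pow, inv_pow, Real.sq_sqrt (Nat.cast_nonneg T),
            ← mul_inv, inv_mul_eq_div]
        split_ifs
        · rw [hscale]
        · rw [hscale]
      · intro b _ hb
        rw [workspaceDft_mulVec_apply, hf]
        simp only [hb, if_false]
        rw [← Pi.zero_def, mulVec_zero]
        simp
      · simp
    simp only [ht]
    rw [sum_groverAmplitude_split, hθ]
    have hc : (T - T * Real.sin θ ^ 2 : ℝ) = T * Real.cos θ ^ 2 := by
      rw [Real.cos_sq']
      ring
    rw [hc]
    -- For `cos θ = 0` there are no unmarked labels to contribute `Y`, but `Y` vanishes as well.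
    by_cases hcos : Real.cos θ = 0
    · have : Y = 0 := by
        rw [hY]
        simp only [cos_odd_mul_eq_zero hcos, mul_zero, Complex.ofReal_zero]
        rw [← Pi.zero_def, mulVec_zero, Pi.zero_apply]
      rw [this, hcos]
      field_simp
      simp
    · field_simp
  rw [hprob, Fintype.sum_prod_type]
  simp only [Fintype.sum_prod_type]
  rw [Finset.sum_congr rfl fun t _ => Finset.sum_comm, Finset.sum_comm]
  refine Finset.sum_congr rfl fun k _ => ?_
  split_ifs with hk
  · exact hsum k
  · simp

end OutputDistribution

/-! ### Window polynomials: tail and peak estimates. -/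

section Window

/-- The polynomial `1 + X + ⋯ + X^(ℓ-1)`. -/
noncomputable def geomPoly (ℓ : ℕ) : ℝ[X] := ∑ i ∈ Finset.range ℓ, X ^ i

theorem natDegree_geomPoly_le (ℓ : ℕ) : (geomPoly ℓ).natDegree ≤ ℓ - 1 := by
  refine natDegree_sum_le_of_forall_le _ _ fun i hi => ?_
  rw [natDegree_X_pow]
  have := Finset.mem_range.1 hi
  omega

theorem geomPoly_eval_one (ℓ : ℕ) : (geomPoly ℓ).eval 1 = ℓ := by
  simp [geomPoly, eval_finsetSum]

theorem aeval_geomPoly (ℓ : ℕ) (z : ℂ) : aeval z (geomPoly ℓ) = ∑ i ∈ Finset.range ℓ, z ^ i := by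
  simp [geomPoly]

theorem geomPoly_ne_zero {ℓ : ℕ} (hℓ : 0 < ℓ) : geomPoly ℓ ≠ 0 := by
  intro h
  have := geomPoly_eval_one ℓ
  rw [h, eval_zero] at this
  have : (ℓ : ℝ) ≠ 0 := by positivity
  simp_all

theorem coeffNormSq_geomPoly {ℓ : ℕ} (hℓ : 0 < ℓ) : coeffNormSq (geomPoly ℓ) = ℓ := by
  have h := natDegree_geomPoly_le ℓ
  rw [coeffNormSq_eq_sum (n := ℓ) (by omega)]
  have : ∀ j ∈ Finset.range ℓ, (geomPoly ℓ).coeff j ^ 2 = 1 := by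
    intro j hj
    simp only [geomPoly, finsetSum_coeff, coeff_X_pow, Finset.sum_ite_eq, hj, if_true, one_pow]
  rw [Finset.sum_congr rfl this]
  simp

/-- Cauchy–Schwarz for the coefficients of a polynomial. -/
theorem eval_one_sq_le (q : ℝ[X]) : q.eval 1 ^ 2 ≤ (q.natDegree + 1) * coeffNormSq q := by
  rw [eval_eq_sum_range]
  have := sq_sum_le_card_mul_sum_sq (s := Finset.range (q.natDegree + 1)) (f := fun j => q.coeff j)
  simpa [coeffNormSq] using this

theorem natDegree_geomPoly_pow_le (ℓ r : ℕ) : (geomPoly ℓ ^ r).natDegree ≤ r * (ℓ - 1) :=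
  natDegree_pow_le.trans (Nat.mul_le_mul_left r (natDegree_geomPoly_le ℓ))

/-- Cauchy–Schwarz at the point `1`, where the polynomial equals `ℓ ^ r`, with at most `r * ℓ`
coefficients. -/
theorem le_coeffNormSq_geomPoly_pow {ℓ r : ℕ} (hℓ : 0 < ℓ) (hr : 0 < r) :
    ((ℓ : ℝ) ^ r) ^ 2 ≤ r * ℓ * coeffNormSq (geomPoly ℓ ^ r) := by
  have h := eval_one_sq_le (geomPoly ℓ ^ r)
  rw [eval_pow, geomPoly_eval_one] at h
  have hd : (geomPoly ℓ ^ r).natDegree + 1 ≤ r * ℓ := by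
    have h1 := natDegree_geomPoly_pow_le ℓ r
    obtain ⟨m, rfl⟩ := Nat.exists_eq_succ_of_ne_zero hℓ.ne'
    simp only [Nat.succ_eq_add_one, Nat.add_sub_cancel] at h1 ⊢
    nlinarith
  refine h.trans (mul_le_mul_of_nonneg_right ?_ (Finset.sum_nonneg fun _ _ => sq_nonneg _))
  exact_mod_cast hd

/-- Take norms in `(z - 1)(1 + ⋯ + z^(ℓ-1)) = z^ℓ - 1`: the right side is at most `2`, and `|z - 1|`
is twice the sine. -/
theorem norm_aeval_geomPoly_mul_le (ℓ : ℕ) (L : ℕ) (ψ : ℝ) (k : ℕ) :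
    ‖aeval (gridPoint L (2 * ψ) k) (geomPoly ℓ)‖ * |Real.sin (ψ - Real.pi * k / L)| ≤ 1 := by
  set z := gridPoint L (2 * ψ) k with hz
  have hz1 : ‖z‖ = 1 := Complex.norm_exp_ofReal_mul_I _
  have hz2 : ‖z - 1‖ = 2 * |Real.sin (ψ - Real.pi * k / L)| := by
    have := Complex.norm_exp_I_mul_ofReal_sub_one (2 * (ψ - Real.pi * k / L))
    rw [mul_div_cancel_left₀ _ two_ne_zero, norm_mul, Real.norm_eq_abs, Real.norm_eq_abs,
      abs_two] at this
    rw [← this, hz, gridPoint]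
    congr 3
    push_cast
    ring
  have h := congrArg norm (mul_geom_sum z ℓ)
  rw [norm_mul, hz2, ← aeval_geomPoly] at h
  have h3 : ‖z ^ ℓ - 1‖ ≤ 2 := by
    refine (norm_sub_le _ _).trans ?_
    rw [norm_pow, hz1]
    norm_num
  linarith

/-- Outside an `η`-neighbourhood of the peak the density induced by a power of `geomPoly` has
exponentially small mass. -/
theorem sum_gridWeight_tail_le {ℓ L s : ℕ} [NeZero L] (hℓ : 0 < ℓ) (hℓL : ℓ ≤ L) (ψ : ℝ) {η : ℝ}
    (hη : 0 < η) :
    ∑ k : Fin L, (if η < |Real.sin (ψ - Real.pi * (k : ℕ) / L)| then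
      gridWeight (geomPoly ℓ ^ (s + 1)) L (2 * ψ) k else 0) ≤ (s + 1) / (ℓ * η) ^ (2 * s) := by
  have hL : (0 : ℝ) < L := by exact_mod_cast NeZero.pos L
  have hℓ' : (0 : ℝ) < ℓ := by exact_mod_cast hℓ
  have hZ := coeffNormSq_pos (pow_ne_zero (s + 1) (geomPoly_ne_zero hℓ))
  set Z := coeffNormSq (geomPoly ℓ ^ (s + 1)) with hZdef
  -- Of the `2s + 2` factors, `2s` are bounded pointwise by `1 / η`; the remaining square is summed
  -- exactly by Parseval.
  have hterm : ∀ k : Fin L, (if η < |Real.sin (ψ - Real.pi * (k : ℕ) / L)| then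
      gridWeight (geomPoly ℓ ^ (s + 1)) L (2 * ψ) k else 0) ≤
      ‖aeval (gridPoint L (2 * ψ) k) (geomPoly ℓ)‖ ^ 2 * ((1 / η) ^ (2 * s) / (L * Z)) := by
    intro k
    split_ifs with hk
    · have h1 := norm_aeval_geomPoly_mul_le ℓ L ψ k
      have h2 : ‖aeval (gridPoint L (2 * ψ) k) (geomPoly ℓ)‖ ≤ 1 / η := by
        rw [le_div_iff₀ hη]
        exact (mul_le_mul_of_nonneg_left hk.le (norm_nonneg _)).trans h1
      rw [gridWeight, map_pow, norm_pow, ← hZdef, ← pow_mul]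
      have h3 : (s + 1) * 2 = 2 + 2 * s := by ring
      rw [h3, pow_add, mul_div_assoc]
      gcongr
    · positivity
  refine (Finset.sum_le_sum fun k _ => hterm k).trans ?_
  have hd := natDegree_geomPoly_le ℓ
  rw [← Finset.sum_mul, sum_norm_sq_aeval_gridPoint (by omega), coeffNormSq_geomPoly hℓ]
  have hZ' := le_coeffNormSq_geomPoly_pow hℓ s.succ_pos
  rw [← hZdef] at hZ'
  have h4 : ((ℓ : ℝ) ^ (s + 1)) ^ 2 = ℓ ^ (2 * s) * ℓ * ℓ := by ring
  rw [Nat.succ_eq_add_one, h4] at hZ'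
  push_cast at hZ'
  have h5 : (ℓ : ℝ) ^ (2 * s) * ℓ ≤ (s + 1) * Z := by nlinarith
  rw [mul_pow, one_div, inv_pow]
  rw [show (L * ℓ * ((η ^ (2 * s))⁻¹ / (L * Z)) : ℝ) = ℓ / (Z * η ^ (2 * s)) by field_simp]
  rw [div_le_div_iff₀ (by positivity) (by positivity)]
  have h6 : 0 < η ^ (2 * s) := by positivity
  nlinarith

/-- All summands `z^i` have argument of size at most `1`, hence real part at least `1 - 1/2`. -/
theorem le_norm_aeval_geomPoly {ℓ : ℕ} (hℓ : 0 < ℓ) (L : ℕ) {ψ : ℝ} {k : ℕ}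
    (h : |ψ - Real.pi * k / L| ≤ 1 / (2 * ℓ)) :
    (ℓ : ℝ) / 2 ≤ ‖aeval (gridPoint L (2 * ψ) k) (geomPoly ℓ)‖ := by
  have hℓ' : (0 : ℝ) < ℓ := by exact_mod_cast hℓ
  refine le_trans ?_ (Complex.re_le_norm _)
  rw [aeval_geomPoly, Complex.re_sum]
  have hterm : ∀ i ∈ Finset.range ℓ, (1 / 2 : ℝ) ≤ (gridPoint L (2 * ψ) k ^ i).re := by
    intro i hi
    have hi' : (i : ℝ) ≤ ℓ := by exact_mod_cast (Finset.mem_range.1 hi).le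
    have : gridPoint L (2 * ψ) k ^ i =
        Complex.exp ((i * (2 * (ψ - Real.pi * k / L)) : ℝ) * Complex.I) := by
      rw [gridPoint, ← Complex.exp_nat_mul]
      congr 1
      push_cast
      ring
    rw [this, Complex.exp_ofReal_mul_I_re]
    have hx : |i * (2 * (ψ - Real.pi * k / L))| ≤ 1 := by
      rw [abs_mul, abs_mul, abs_two, Nat.abs_cast]
      calc (i : ℝ) * (2 * |ψ - Real.pi * k / L|) ≤ ℓ * (2 * (1 / (2 * ℓ))) := by gcongr
        _ = 1 := by field_simp
    have hx2 : (i * (2 * (ψ - Real.pi * k / L))) ^ 2 ≤ 1 := by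
      rw [← sq_abs]
      exact pow_le_one₀ (abs_nonneg _) hx
    have := Real.one_sub_sq_div_two_le_cos (x := i * (2 * (ψ - Real.pi * k / L)))
    linarith
  calc (ℓ : ℝ) / 2 = ∑ i ∈ Finset.range ℓ, (1 / 2 : ℝ) := by
        rw [Finset.sum_const, Finset.card_range, nsmul_eq_mul, mul_one_div]
    _ ≤ _ := Finset.sum_le_sum hterm

/-- Near its peak the density induced by `geomPoly ℓ` is of order `ℓ`. -/
theorem le_sum_gridWeight_peak {ℓ L : ℕ} (hℓ : 0 < ℓ) {ψ η : ℝ} (hη : 0 < η)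
    (hηψ : η ≤ ψ) (hψ : ψ ≤ Real.pi / 2) (hηℓ : η ≤ 1 / (2 * ℓ)) (hL : 2 * Real.pi / η ≤ L) :
    ℓ * η / (8 * Real.pi) ≤ ∑ k : Fin L, (if |Real.sin (ψ - Real.pi * (k : ℕ) / L)| ≤ η then
      gridWeight (geomPoly ℓ) L (2 * ψ) k else 0) := by
  have hπ := Real.pi_pos
  have hℓ' : (0 : ℝ) < ℓ := by exact_mod_cast hℓ
  have hL0 : (0 : ℝ) < L := lt_of_lt_of_le (by positivity) hL
  rw [Fin.sum_univ_eq_sum_range fun k => if |Real.sin (ψ - Real.pi * k / L)| ≤ η then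
      gridWeight (geomPoly ℓ) L (2 * ψ) k else 0]
  -- The grid points with angle in `[ψ - η, ψ]`. Taking only this side of the peak avoids
  -- wrap-around, since `0 ≤ ψ - η` and `ψ ≤ π / 2`.
  set I := Finset.Icc ⌈L * (ψ - η) / Real.pi⌉₊ ⌊L * ψ / Real.pi⌋₊ with hI
  have hy : 0 ≤ L * ψ / Real.pi := by
    have : 0 ≤ ψ := hη.le.trans hηψ
    positivity
  have hx : 0 ≤ L * (ψ - η) / Real.pi := by
    have : 0 ≤ ψ - η := by linarith
    positivity
  have hmem : ∀ k ∈ I, L * (ψ - η) / Real.pi ≤ k ∧ (k : ℝ) ≤ L * ψ / Real.pi := by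
    intro k hk
    rw [hI, Finset.mem_Icc] at hk
    exact ⟨(Nat.le_ceil _).trans (by exact_mod_cast hk.1),
      le_trans (by exact_mod_cast hk.2) (Nat.floor_le hy)⟩
  have hsub : I ⊆ Finset.range L := by
    intro k hk
    have h1 := (hmem k hk).2
    rw [Finset.mem_range]
    have h2 : L * ψ / Real.pi < L := by
      rw [div_lt_iff₀ hπ]
      nlinarith
    exact_mod_cast h1.trans_lt h2
  have hterm : ∀ k ∈ I, (ℓ : ℝ) / (4 * L) ≤ if |Real.sin (ψ - Real.pi * k / L)| ≤ η then
      gridWeight (geomPoly ℓ) L (2 * ψ) k else 0 := by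
    intro k hk
    obtain ⟨h1, h2⟩ := hmem k hk
    rw [div_le_iff₀ hπ] at h1
    rw [le_div_iff₀ hπ] at h2
    have h3 : |ψ - Real.pi * k / L| ≤ η := by
      have h4 : Real.pi * k / L ≤ ψ := by
        rw [div_le_iff₀ hL0]
        linarith
      have h5 : ψ - η ≤ Real.pi * k / L := by
        rw [le_div_iff₀ hL0]
        linarith
      rw [abs_le]
      constructor <;> linarith
    rw [if_pos (Real.abs_sin_le_abs.trans h3), gridWeight, coeffNormSq_geomPoly hℓ]
    have h6 := le_norm_aeval_geomPoly hℓ L (h3.trans hηℓ)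
    calc (ℓ : ℝ) / (4 * L) = (ℓ / 2) ^ 2 / (L * ℓ) := by
          field_simp
          norm_num
      _ ≤ _ := by gcongr
  -- The interval has length `Lη/π ≥ 2` in grid units, so rounding its ends loses at most half of
  -- it.
  have hcard : L * η / (2 * Real.pi) ≤ I.card := by
    have h1 := Nat.lt_floor_add_one (L * ψ / Real.pi)
    have h2 := Nat.ceil_lt_add_one hx
    have h3 : (⌊L * ψ / Real.pi⌋₊ : ℝ) + 1 - ⌈L * (ψ - η) / Real.pi⌉₊ ≤ I.card := by
      rw [hI, Nat.card_Icc, sub_le_iff_le_add]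
      exact_mod_cast le_tsub_add
    have h4 : L * ψ / Real.pi - L * (ψ - η) / Real.pi = 2 * (L * η / (2 * Real.pi)) := by
      field_simp
      ring
    have h5 : 1 ≤ L * η / (2 * Real.pi) := by
      rw [le_div_iff₀ (by positivity), one_mul]
      rwa [div_le_iff₀ hη] at hL
    linarith
  calc ℓ * η / (8 * Real.pi) = L * η / (2 * Real.pi) * (ℓ / (4 * L)) := by
        field_simp
        norm_num
    _ ≤ I.card * (ℓ / (4 * L)) := by gcongr
    _ = ∑ k ∈ I, (ℓ : ℝ) / (4 * L) := by rw [Finset.sum_const, nsmul_eq_mul]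
    _ ≤ _ := Finset.sum_le_sum hterm
    _ ≤ _ := Finset.sum_le_sum_of_subset_of_nonneg hsub fun k _ _ => by
        split_ifs
        · exact gridWeight_nonneg _ _ _ _
        · exact le_rfl

end Window

/-! ### Choice of parameters and the two regimes of `δ`. -/

section Estimation

/-- The number of convolution factors of the window used for confidence `δ`. -/
noncomputable def windowPower (δ : ℝ) : ℕ :=
  if Real.log (1 / δ) < 1 / 128 then 1 else ⌈Real.log (1 / δ)⌉₊ + 1

/-- The length of each factor of the window. -/
noncomputable def windowLength (M : ℕ) (δ : ℝ) : ℕ := M / 2 / windowPower δ + 1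

/-- The angular resolution that `M` queries have to achieve. -/
noncomputable def resolution (M : ℕ) (δ : ℝ) : ℝ := 16384 * Real.log (1 / δ) / (3 * M)

/-- The dimension of the control register. -/
noncomputable def gridSize (M : ℕ) (δ : ℝ) : ℕ :=
  M / 2 + 1 + ⌈2 * Real.pi / min (resolution M δ) (1 / (2 * windowLength M δ))⌉₊

instance (M : ℕ) (δ : ℝ) : NeZero (gridSize M δ) := ⟨by rw [gridSize]; omega⟩

/-- Relative estimation of `D(S)` by amplitude estimation with an `M`-query window. -/
noncomputable def mulEstProb (N T : ℕ) [NeZero N] [NeZero T] (S : Finset (Fin N)) (M : ℕ) (δ : ℝ) :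
    QueryAlgorithm N T :=
  amplitudeEstimation N T S M (gridSize M δ)
    (controlAmplitude (geomPoly (windowLength M δ) ^ windowPower δ) (gridSize M δ))

theorem QueryAlgorithm.outputProb_nonneg {N T : ℕ} [NeZero N] (A : QueryAlgorithm N T)
    (O : Fin T → Fin N) (E : Set ℝ) : 0 ≤ A.outputProb O E := by
  refine Finset.sum_nonneg fun x _ => ?_
  split_ifs
  · positivity
  · exact le_rfl

theorem Represents.card_filter_mem {N T : ℕ} [NeZero T] {O : Fin T → Fin N} {D : Fin N → ℝ}
    (h : Represents O D) (S : Finset (Fin N)) :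
    ((Finset.univ.filter fun t => O t ∈ S).card : ℝ) = T * weight D S := by
  have hT : (T : ℝ) ≠ 0 := by exact_mod_cast NeZero.ne T
  have h1 : (Finset.univ.filter fun t => O t ∈ S).card =
      ∑ i ∈ S, (Finset.univ.filter fun t => O t = i).card := by
    rw [Finset.card_eq_sum_card_fiberwise (f := O) (t := S) fun t ht => by simpa using ht]
    refine Finset.sum_congr rfl fun i hi => ?_
    congr 1
    ext t
    simp only [Finset.mem_filter, Finset.mem_univ, true_and]
    exact ⟨fun h => h.2, fun h => ⟨h ▸ hi, h⟩⟩
  rw [weight, Finset.sum_congr rfl fun i _ => h i, ← Finset.sum_div, mul_div_cancel₀ _ hT, h1]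
  push_cast
  rfl

/-- An angle close to `θ` has a squared sine with small relative error. -/
theorem sin_sq_mem_Icc {θ y ε : ℝ} (hθ : 0 ≤ Real.sin θ) (hε : 0 ≤ ε) (hε1 : ε ≤ 1)
    (h : |Real.sin (θ - y)| ≤ ε * Real.sin θ / 3) :
    Real.sin y ^ 2 ∈
      Set.Icc ((1 - ε) * Real.sin θ ^ 2) ((1 + ε) * Real.sin θ ^ 2) := by
  set d := |Real.sin (θ - y)| with hd
  -- This factorisation involves only sines of the angles, so `y` matters only modulo `π`.
  have h1 : Real.sin θ ^ 2 - Real.sin y ^ 2 = Real.sin (θ - y) * Real.sin (θ + y) := by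
    rw [Real.sin_sub, Real.sin_add]
    linear_combination Real.sin y ^ 2 * Real.sin_sq_add_cos_sq θ -
      Real.sin θ ^ 2 * Real.sin_sq_add_cos_sq y
  have h2 : |Real.sin (θ + y)| ≤ d + 2 * Real.sin θ := by
    have h3 : θ + y = 2 * θ - (θ - y) := by ring
    have h4 : |Real.sin (2 * θ)| ≤ 2 * Real.sin θ := by
      rw [Real.sin_two_mul, abs_mul, abs_of_nonneg (by positivity : 0 ≤ 2 * Real.sin θ)]
      exact mul_le_of_le_one_right (by positivity) (Real.abs_cos_le_one θ)
    rw [h3, Real.sin_sub]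
    refine (abs_sub _ _).trans ?_
    rw [abs_mul, abs_mul]
    have h5 := mul_le_of_le_one_right (abs_nonneg (Real.sin (2 * θ)))
      (Real.abs_cos_le_one (θ - y))
    have h6 := mul_le_of_le_one_left (abs_nonneg (Real.sin (θ - y)))
      (Real.abs_cos_le_one (2 * θ))
    linarith
  have h7 : |Real.sin θ ^ 2 - Real.sin y ^ 2| ≤ ε * Real.sin θ ^ 2 := by
    rw [h1, abs_mul]
    calc d * |Real.sin (θ + y)| ≤ d * (d + 2 * Real.sin θ) :=
          mul_le_mul_of_nonneg_left h2 (abs_nonneg _)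
      _ ≤ ε * Real.sin θ / 3 * (ε * Real.sin θ / 3 + 2 * Real.sin θ) := by
          gcongr
      _ ≤ ε * Real.sin θ / 3 * (1 * Real.sin θ / 3 + 2 * Real.sin θ) := by
          gcongr
      _ ≤ ε * Real.sin θ ^ 2 := by
          have : 0 ≤ ε * Real.sin θ ^ 2 := by positivity
          nlinarith
  rw [abs_le] at h7
  constructor <;> linarith [h7.1, h7.2]

/-- Only the window centred at `2θ` is used; the one at `-2θ` is discarded, at the cost of a factor
`2`. The assumption `resolution M δ ≤ θ` keeps the peak interval in the range of the grid. -/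
theorem one_sub_le_outputProb_of_lt {N T : ℕ} [NeZero N] [NeZero T] {S : Finset (Fin N)} {M : ℕ}
    {δ : ℝ} (hδ : 0 < δ) (hlog : 0 < Real.log (1 / δ)) (hM : 0 < M)
    (hsmall : Real.log (1 / δ) < 1 / 128) {O : Fin T → Fin N} {θ : ℝ}
    (hθ : ((Finset.univ.filter fun t => O t ∈ S).card : ℝ) = T * Real.sin θ ^ 2)
    (hs : 0 < Real.sin θ) (hθ2 : θ ≤ Real.pi / 2) (hres : resolution M δ ≤ θ) {E : Set ℝ}
    (hE : ∀ y, |Real.sin (θ - y)| ≤ resolution M δ → Real.sin y ^ 2 ∈ E) :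
    1 - δ ≤ (mulEstProb N T S M δ).outputProb O E := by
  classical
  have hM' : (0 : ℝ) < M := by exact_mod_cast hM
  have hpow : windowPower δ = 1 := if_pos hsmall
  have hlen : windowLength M δ = M / 2 + 1 := by rw [windowLength, hpow, Nat.div_one]
  have hℓ : 0 < windowLength M δ := Nat.succ_pos _
  have hℓ' : (0 : ℝ) < windowLength M δ := by exact_mod_cast hℓ
  have hℓM : (M : ℝ) ≤ 2 * windowLength M δ := by
    rw [hlen]
    exact_mod_cast (by omega : M ≤ 2 * (M / 2 + 1))
  have hres0 : 0 < resolution M δ := by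
    rw [resolution]
    positivity
  have hd := natDegree_geomPoly_le (windowLength M δ)
  have hL : windowLength M δ ≤ gridSize M δ := by
    rw [hlen, gridSize]
    omega
  have hdM : (geomPoly (windowLength M δ)).natDegree ≤ M / 2 := by omega
  have hdL : (geomPoly (windowLength M δ)).natDegree < gridSize M δ := by omega
  set η := min (resolution M δ) (1 / (2 * windowLength M δ)) with hη
  have hη0 : 0 < η := lt_min hres0 (by positivity)
  have hgrid : 2 * Real.pi / η ≤ gridSize M δ := by
    rw [gridSize, ← hη]
    push_cast
    have h1 := Nat.le_ceil (2 * Real.pi / η)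
    have h2 : (0 : ℝ) ≤ (M / 2 : ℕ) := Nat.cast_nonneg _
    linarith
  have hpeak := le_sum_gridWeight_peak hℓ hη0 ((min_le_left _ _).trans hres) hθ2
    (min_le_right _ _) hgrid
  rw [mulEstProb, hpow, pow_one,
    outputProb_amplitudeEstimation hθ hs.ne' hdM hdL (geomPoly_ne_zero hℓ)]
  have hδlog : 1 - δ ≤ Real.log (1 / δ) := by
    have := Real.one_sub_inv_le_log_of_pos (one_div_pos.2 hδ)
    rwa [one_div, inv_inv, ← one_div] at this
  have hmain : Real.log (1 / δ) ≤ windowLength M δ * η / (8 * Real.pi) / 2 := by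
    have hπ := Real.pi_lt_d2
    have hπ0 := Real.pi_pos
    rw [div_div, le_div_iff₀ (by positivity)]
    -- If the resolution is the minimum, the mass is a multiple of `log (1/δ)`, as `ℓ ≥ M / 2`.
    -- Otherwise it is an absolute constant, and the threshold `1/128` is small enough for it.
    rcases min_choice (resolution M δ) (1 / (2 * (windowLength M δ : ℝ))) with h | h
    · rw [hη, h, resolution, mul_div_assoc', le_div_iff₀ (by positivity)]
      calc Real.log (1 / δ) * (8 * Real.pi * 2) * (3 * M)
          ≤ Real.log (1 / δ) * (8 * 3.15 * 2) * (3 * (2 * windowLength M δ)) := by gcongr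
        _ ≤ windowLength M δ * (16384 * Real.log (1 / δ)) := by
          have : 0 < Real.log (1 / δ) * windowLength M δ := by positivity
          linarith
    · rw [hη, h]
      have h1 : (windowLength M δ : ℝ) * (1 / (2 * windowLength M δ)) = 1 / 2 := by field_simp
      rw [h1]
      calc Real.log (1 / δ) * (8 * Real.pi * 2) ≤ 1 / 128 * (8 * 3.15 * 2) := by gcongr
        _ ≤ 1 / 2 := by norm_num
  refine hδlog.trans (hmain.trans ((div_le_div_of_nonneg_right hpeak zero_le_two).trans ?_))
  rw [Finset.sum_div]
  refine Finset.sum_le_sum fun k _ => ?_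
  have h1 := gridWeight_nonneg (geomPoly (windowLength M δ)) (gridSize M δ) (2 * θ) k
  have h2 := gridWeight_nonneg (geomPoly (windowLength M δ)) (gridSize M δ) (-(2 * θ)) k
  split_ifs with h3 h4 h4
  · linarith
  · exact absurd (hE _ (h3.trans (min_le_left _ _))) h4
  · linarith
  · simp

/-- Each of the two windows has total mass `1` and tail mass at most `δ`, hence so has their
average. -/
theorem one_sub_le_outputProb_of_le {N T : ℕ} [NeZero N] [NeZero T] {S : Finset (Fin N)} {M : ℕ}
    {δ : ℝ} (hδ : 0 < δ) (hM : 0 < M) (hlarge : 1 / 128 ≤ Real.log (1 / δ)) {O : Fin T → Fin N}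
    {θ : ℝ} (hθ : ((Finset.univ.filter fun t => O t ∈ S).card : ℝ) = T * Real.sin θ ^ 2)
    (hs : Real.sin θ ≠ 0) {E : Set ℝ}
    (hE : ∀ y, |Real.sin (θ - y)| ≤ resolution M δ → Real.sin y ^ 2 ∈ E) :
    1 - δ ≤ (mulEstProb N T S M δ).outputProb O E := by
  classical
  have hM' : (0 : ℝ) < M := by exact_mod_cast hM
  have hlog : 0 < Real.log (1 / δ) := by linarith
  set s := ⌈Real.log (1 / δ)⌉₊ with hsdef
  have hpow : windowPower δ = s + 1 := if_neg hlarge.not_gt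
  have hlen : windowLength M δ = M / 2 / (s + 1) + 1 := by rw [windowLength, hpow]
  have hℓ : 0 < windowLength M δ := Nat.succ_pos _
  have hd : (geomPoly (windowLength M δ) ^ (s + 1)).natDegree ≤ M / 2 := by
    refine (natDegree_geomPoly_pow_le _ _).trans ?_
    rw [hlen, Nat.add_sub_cancel]
    exact Nat.mul_div_le _ _
  have hL : windowLength M δ ≤ gridSize M δ := by
    have : M / 2 / (s + 1) ≤ M / 2 := Nat.div_le_self _ _
    rw [hlen, gridSize]
    omega
  have hdL : (geomPoly (windowLength M δ) ^ (s + 1)).natDegree < gridSize M δ := by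
    refine hd.trans_lt ?_
    rw [gridSize]
    omega
  have hres0 : 0 < resolution M δ := by
    rw [resolution]
    positivity
  have hne := pow_ne_zero (s + 1) (geomPoly_ne_zero hℓ)
  set q := geomPoly (windowLength M δ) ^ (s + 1) with hq
  have htail : (s + 1) / (windowLength M δ * resolution M δ) ^ (2 * s) ≤ δ := by
    -- The ceiling gives `s + 1 < log (1/δ) + 2`, and `2 ≤ 256 log (1/δ)` in this regime.
    have hs1 : (s : ℝ) + 1 ≤ 257 * Real.log (1 / δ) := by
      have := Nat.ceil_lt_add_one hlog.le
      rw [← hsdef] at this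
      linarith
    have hℓM : (M : ℝ) ≤ 2 * (windowLength M δ * (s + 1)) := by
      have h1 := Nat.lt_div_mul_add (a := M / 2) s.succ_pos
      have h2 : M ≤ 2 * (windowLength M δ * (s + 1)) := by
        rw [hlen, add_mul, one_mul]
        simp only [Nat.succ_eq_add_one] at h1
        omega
      exact_mod_cast h2
    -- This needs `8 · 3 · 2 · 257 = 12336 ≤ 16384`. The value `8` makes the tail at most `2^s /
    -- 64^s = 32^(-s)`, which is below `exp (-s) ≤ δ`.
    have h8 : 8 ≤ windowLength M δ * resolution M δ := by
      have hℓ' : (0 : ℝ) < windowLength M δ := by exact_mod_cast hℓ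
      rw [resolution, mul_div_assoc', le_div_iff₀ (by positivity)]
      calc 8 * (3 * (M : ℝ)) ≤ 8 * (3 * (2 * (windowLength M δ * (257 * Real.log (1 / δ))))) := by
            gcongr
            exact hℓM.trans (by gcongr)
        _ ≤ _ := by
            have : 0 < windowLength M δ * Real.log (1 / δ) := by positivity
            linarith
    have h2 : (s : ℝ) + 1 ≤ 2 ^ s := by exact_mod_cast Nat.lt_two_pow_self
    have hexp : 1 / δ ≤ 32 ^ s := by
      rw [← Real.exp_log (one_div_pos.2 hδ)]
      calc Real.exp (Real.log (1 / δ)) ≤ Real.exp (s * 1) := by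
            rw [mul_one]
            exact Real.exp_le_exp.2 (Nat.le_ceil _)
        _ = Real.exp 1 ^ s := Real.exp_nat_mul _ _
        _ ≤ 32 ^ s := by
            gcongr
            linarith [Real.exp_one_lt_d9]
    calc (s + 1) / (windowLength M δ * resolution M δ) ^ (2 * s) ≤ 2 ^ s / 8 ^ (2 * s) := by gcongr
      _ = 1 / 32 ^ s := by
          rw [pow_mul, ← div_pow, ← _root_.one_div_pow]
          norm_num
      _ ≤ δ := by
          rw [div_le_iff₀ (by positivity)]
          rwa [div_le_iff₀ hδ, mul_comm] at hexp
  have hbound : ∀ ψ, ∑ k : Fin (gridSize M δ),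
      (if resolution M δ < |Real.sin (ψ - Real.pi * (k : ℕ) / gridSize M δ)| then
        gridWeight q (gridSize M δ) (2 * ψ) k else 0) ≤ δ :=
    fun ψ => (sum_gridWeight_tail_le hℓ hL ψ hres0).trans htail
  have h1 := hbound θ
  have h2 := hbound (-θ)
  have h3 := sum_gridWeight hdL hne (2 * θ)
  have h4 := sum_gridWeight hdL hne (-(2 * θ))
  rw [mulEstProb, hpow, outputProb_amplitudeEstimation hθ hs hd hdL hne]
  -- Termwise: a grid point whose output misses `E` lies in the tails of both windows.
  have hsum : ∑ k : Fin (gridSize M δ),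
      (gridWeight q (gridSize M δ) (2 * θ) k + gridWeight q (gridSize M δ) (-(2 * θ)) k) ≤
      2 * (∑ k : Fin (gridSize M δ),
        if Real.sin (Real.pi * (k : ℕ) / gridSize M δ) ^ 2 ∈ E then
          (gridWeight q (gridSize M δ) (2 * θ) k +
            gridWeight q (gridSize M δ) (-(2 * θ)) k) / 2 else 0) +
      (∑ k : Fin (gridSize M δ),
        (if resolution M δ < |Real.sin (θ - Real.pi * (k : ℕ) / gridSize M δ)| then
          gridWeight q (gridSize M δ) (2 * θ) k else 0) +
      ∑ k : Fin (gridSize M δ),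
        (if resolution M δ < |Real.sin (-θ - Real.pi * (k : ℕ) / gridSize M δ)| then
          gridWeight q (gridSize M δ) (2 * -θ) k else 0)) := by
    rw [Finset.mul_sum, ← Finset.sum_add_distrib, ← Finset.sum_add_distrib]
    refine Finset.sum_le_sum fun k _ => ?_
    have g1 := gridWeight_nonneg q (gridSize M δ) (2 * θ) k
    have g2 := gridWeight_nonneg q (gridSize M δ) (-(2 * θ)) k
    rw [mul_neg]
    by_cases hk : Real.sin (Real.pi * (k : ℕ) / gridSize M δ) ^ 2 ∈ E
    · rw [if_pos hk]
      split_ifs <;> linarith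
    · have hk1 : resolution M δ < |Real.sin (θ - Real.pi * (k : ℕ) / gridSize M δ)| := by
        by_contra! h
        exact hk (hE _ h)
      have hk2 : resolution M δ < |Real.sin (-θ - Real.pi * (k : ℕ) / gridSize M δ)| := by
        by_contra! h
        apply hk
        -- The window at `-2θ` peaks at the angle `-θ`, which is harmless because `sin²` is even.
        have := hE (-(Real.pi * (k : ℕ) / gridSize M δ)) (by
          rwa [← abs_neg, ← Real.sin_neg, neg_sub, neg_sub_comm])
        rwa [Real.sin_neg, neg_sq] at this
      rw [if_neg hk, if_pos hk1, if_pos hk2]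
      linarith
  rw [Finset.sum_add_distrib, h3, h4] at hsum
  linarith

end Estimation

end QSamp

theorem mainTheorem8 :
    ∃ c : ℝ, 0 < c ∧
      ∃ MulEstProb : ∀ (N T : ℕ) [NeZero N] [NeZero T],
          Finset (Fin N) → ℕ → ℝ → QSamp.QueryAlgorithm N T,
        ∀ (N T : ℕ) [NeZero N] [NeZero T] (S : Finset (Fin N)) (M : ℕ) (δ : ℝ),
          0 < δ → δ ≤ 1 →
          (MulEstProb N T S M δ).queries = M ∧
          ∀ (D : Fin N → ℝ) (O : Fin T → Fin N),
            D ∈ stdSimplex ℝ (Fin N) → QSamp.Represents O D → 0 < QSamp.weight D S →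
            ∀ ε : ℝ, 0 < ε → ε ≤ 1 →
              c * Real.log (1 / δ) / (ε * √(QSamp.weight D S)) ≤ (M : ℝ) →
              1 - δ ≤ (MulEstProb N T S M δ).outputProb O
                (Set.Icc ((1 - ε) * QSamp.weight D S) ((1 + ε) * QSamp.weight D S)) := by
  refine ⟨16384, by norm_num, fun N T _ _ S M δ => QSamp.mulEstProb N T S M δ, ?_⟩
  intro N T _ _ S M δ hδ hδ1
  refine ⟨rfl, fun D O hD hO hp ε hε hε1 hM => ?_⟩
  -- For `δ = 1` the bound on `M` is vacuous, but so is the claim; otherwise it forces `M > 0`.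
  rcases hδ1.eq_or_lt with rfl | hδ1
  · rw [sub_self]
    exact QSamp.QueryAlgorithm.outputProb_nonneg _ _ _
  have hlog : 0 < Real.log (1 / δ) := Real.log_pos (by rwa [lt_div_iff₀ hδ, one_mul])
  set p := QSamp.weight D S with hpdef
  have hp1 : p ≤ 1 := by
    rw [← hD.2]
    exact Finset.sum_le_sum_of_subset_of_nonneg (Finset.subset_univ S) fun i _ _ => hD.1 i
  have hsqrt : 0 < √p := Real.sqrt_pos.2 hp
  have hM0 : (0 : ℝ) < M := lt_of_lt_of_le (by positivity) hM
  have hsin : Real.sin (Real.arcsin √p) = √p :=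
    Real.sin_arcsin (by linarith) (Real.sqrt_le_one.2 hp1)
  have hsq : Real.sin (Real.arcsin √p) ^ 2 = p := by rw [hsin, Real.sq_sqrt hp.le]
  have hcard := hO.card_filter_mem S
  rw [← hpdef, ← hsq] at hcard
  -- This is the hypothesis on `M` rearranged: `resolution` is built from the same constant `16384`,
  -- and its factor `3` is the one in `sin_sq_mem_Icc`.
  have hres : QSamp.resolution M δ ≤ ε * Real.sin (Real.arcsin √p) / 3 := by
    rw [hsin, QSamp.resolution, div_le_div_iff₀ (by positivity) (by norm_num)]
    rw [div_le_iff₀ (by positivity)] at hM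
    linarith
  have hE : ∀ y, |Real.sin (Real.arcsin √p - y)| ≤ QSamp.resolution M δ →
      Real.sin y ^ 2 ∈ Set.Icc ((1 - ε) * p) ((1 + ε) * p) := by
    intro y hy
    rw [← hsq]
    exact QSamp.sin_sq_mem_Icc (by rw [hsin]; exact hsqrt.le) hε.le hε1 (hy.trans hres)
  have hs : 0 < Real.sin (Real.arcsin √p) := by rwa [hsin]
  have hM1 : 0 < M := by exact_mod_cast hM0
  rcases lt_or_ge (Real.log (1 / δ)) (1 / 128) with h | h
  · refine QSamp.one_sub_le_outputProb_of_lt hδ hlog hM1 h hcard hs (Real.arcsin_le_pi_div_two _)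
      ?_ hE
    -- The resolution is at most `ε sin θ / 3 ≤ sin θ ≤ θ`.
    have h1 := Real.sin_le (Real.arcsin_nonneg.2 hsqrt.le)
    have h2 := mul_le_of_le_one_left hs.le hε1
    linarith
  · exact QSamp.one_sub_le_outputProb_of_le hδ hM1 h hcard hs.ne' hE
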